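/- Let $\Omega\subset\mathbb R^2$ be a bounded domain with smooth boundary $\Gamma$, partitioned into three measurable parts $\Gamma_1,\Gamma_2,\Gamma_3$ of positive arc-length measure. Let $g>0$, $\xi>0$, $f_0\in L^2(\Omega)$, $f_2\in L^2(\Gamma_2)$, and let $\gamma:H^1(\Omega)\to L^2(\Gamma)$ be the trace operator. Put $$X=\{v\in H^1(\Omega)\mid \gamma v=0\text{ a.e. on }\Gamma_1\},\qquad (u,v)_X=(\nabla u,\nabla v)_{L^2(\Omega)^2},$$ $$a(u,v)=\xi\,(u,v)_X,\qquad (f,v)_X=\int_\Omega f_0\,v\,dx+\int_{\Gamma_2}f_2\,\gamma v\,d\Gamma,\qquad j(v)=\int_{\Gamma_3}g\,|\gamma v|\,d\Gamma ,$$ $$\bar\Lambda=\{\bar\mu\in X'\mid \langle\bar\mu,v\rangle_{X',X}\le j(v)\ \text{ for all } v\in X\}.$$ Let $M=\gamma(X)\subset H^{1/2}(\Gamma)$, normed by $\|w\|_{H^{1/2}(\Gamma)}=\inf\{\|v\|_{H^1(\Omega)}\mid v\in H^1(\Omega),\ \gamma v=w\}$, let $Y=M'$, and let $B:X\to Y'$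 be the operator given by $\langle Bv,\mu\rangle_{Y',Y}=\langle\mu,\gamma v\rangle_{Y,M}$ for $v\in X$, $\mu\in Y$. Let $(\bar u,\bar\lambda)\in X\times\bar\Lambda$ be the solution (which is known to be unique) of the mixed problem $$a(\bar u,v)+\langle\bar\lambda,v\rangle_{X',X}=(f,v)_X\ \text{ for all } v\in X,\qquad \langle\bar\mu-\bar\lambda,\bar u\rangle_{X',X}\le 0\ \text{ for all }\bar\mu\in\bar\Lambda .$$ Then $\bar\lambda$ belongs to the polar of $\operatorname{Ker}B=\{v\in X\mid Bv=0\}$, that is, $$\bar\lambda\in(\operatorname{Ker}B)^0=\{l\in X'\mid \langle l,v\rangle_{X',X}=0\ \text{ for all } v\in\operatorname{Ker}B\}.$$ -/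

import Mathlib

open MeasureTheory Set
open scoped ContDiff MeasureTheory

noncomputable section

namespace FrictionalContact

/-- The Euclidean plane. -/
abbrev Plane : Type := EuclideanSpace ℝ (Fin 2)

/-- `Ω` has a smooth (`C^∞`) boundary: near each boundary point, after a linear isometric change of
coordinates, `Ω` is the set of points lying strictly above the graph of a smooth function. -/
def HasSmoothBoundary (Ω : Set Plane) : Prop :=
  ∀ x ∈ frontier Ω, ∃ (R : Plane ≃ₗᵢ[ℝ] Plane) (h : ℝ → ℝ) (r : ℝ), 0 < r ∧ ContDiff ℝ ∞ h ∧
    ∀ y ∈ Metric.ball x r, (y ∈ Ω ↔ h (R y 0) < R y 1)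

/-- The boundary measure `dΓ`: arc length on `Γ = ∂Ω`. -/
def bdryMeasure (Ω : Set Plane) : Measure Plane := (μH[1] : Measure Plane).restrict (frontier Ω)

/-- `L²(Ω)`. -/
abbrev L2 (Ω : Set Plane) : Type := Lp ℝ 2 (volume.restrict Ω)

/-- `L²(Ω)²`. -/
abbrev L2Vec (Ω : Set Plane) : Type := Lp Plane 2 (volume.restrict Ω)

/-- `L²(Γ)`. -/
abbrev L2Bdry (Ω : Set Plane) : Type := Lp ℝ 2 (bdryMeasure Ω)

/-- Smooth functions with compact support in `Ω`. -/
structure IsTestFunction (Ω : Set Plane) (φ : Plane → ℝ) : Prop where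
  contDiff : ContDiff ℝ ∞ φ
  hasCompactSupport : HasCompactSupport φ
  tsupport_subset : tsupport φ ⊆ Ω

/-- `p` is the weak gradient of `v` on `Ω`. -/
def IsWeakGradient (Ω : Set Plane) (v : L2 Ω) (p : L2Vec Ω) : Prop :=
  ∀ φ : Plane → ℝ, IsTestFunction Ω φ → ∀ e : Plane,
    ∫ x in Ω, v x * fderiv ℝ φ x e = -∫ x in Ω, (inner ℝ e (p x)) * φ x

theorem IsTestFunction.memLp {Ω : Set Plane} {φ : Plane → ℝ} (h : IsTestFunction Ω φ) :
    MemLp φ 2 (volume.restrict Ω) :=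
  (h.contDiff.continuous.memLp_of_hasCompactSupport h.hasCompactSupport).restrict Ω

theorem IsTestFunction.memLp_fderiv {Ω : Set Plane} {φ : Plane → ℝ} (h : IsTestFunction Ω φ)
    (e : Plane) : MemLp (fun x => fderiv ℝ φ x e) 2 (volume.restrict Ω) := by
  have hc : Continuous (fun x => fderiv ℝ φ x e) :=
    (h.contDiff.continuous_fderiv (by simp)).clm_apply continuous_const
  exact (hc.memLp_of_hasCompactSupport (h.hasCompactSupport.fderiv_apply ℝ e)).restrict Ω

/-- `H¹(Ω)`, realised as the set of pairs `(v, ∇v)` with `v ∈ L²(Ω)` and weak gradient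
`∇v ∈ L²(Ω)²`. The inherited norm is the usual one, `‖v‖² = ‖v‖²_{L²} + ‖∇v‖²_{L²}`. -/
def H1 (Ω : Set Plane) : Submodule ℝ (WithLp 2 (L2 Ω × L2Vec Ω)) where
  carrier := {w | IsWeakGradient Ω w.fst w.snd}
  add_mem' := by
    intro w z hw hz φ hφ e
    have i1 : ∀ v : L2 Ω, Integrable (fun x => v x * fderiv ℝ φ x e) (volume.restrict Ω) :=
      fun v => (Lp.memLp v).integrable_mul (hφ.memLp_fderiv e)
    have i2 : ∀ p : L2Vec Ω, Integrable (fun x => (inner ℝ e (p x)) * φ x) (volume.restrict Ω) :=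
      fun p => ((Lp.memLp p).const_inner e).integrable_mul hφ.memLp
    have e1 : ∫ x in Ω, (w + z).fst x * fderiv ℝ φ x e
        = ∫ x in Ω, (w.fst x * fderiv ℝ φ x e + z.fst x * fderiv ℝ φ x e) := by
      refine integral_congr_ae ?_
      filter_upwards [Lp.coeFn_add w.fst z.fst] with x hx
      rw [WithLp.add_fst, hx, Pi.add_apply, add_mul]
    have e2 : ∫ x in Ω, (inner ℝ e ((w + z).snd x)) * φ x
        = ∫ x in Ω, ((inner ℝ e (w.snd x)) * φ x + (inner ℝ e (z.snd x)) * φ x) := by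
      refine integral_congr_ae ?_
      filter_upwards [Lp.coeFn_add w.snd z.snd] with x hx
      rw [WithLp.add_snd, hx, Pi.add_apply, inner_add_right, add_mul]
    rw [e1, e2, integral_add (i1 _) (i1 _), integral_add (i2 _) (i2 _), hw φ hφ e, hz φ hφ e]
    ring
  zero_mem' := by
    intro φ hφ e
    have e1 : ∫ x in Ω, (0 : WithLp 2 (L2 Ω × L2Vec Ω)).fst x * fderiv ℝ φ x e = 0 := by
      refine integral_eq_zero_of_ae ?_
      filter_upwards [Lp.coeFn_zero ℝ 2 (volume.restrict Ω)] with x hx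
      rw [WithLp.zero_fst, hx]; simp
    have e2 : ∫ x in Ω, (inner ℝ e ((0 : WithLp 2 (L2 Ω × L2Vec Ω)).snd x)) * φ x = 0 := by
      refine integral_eq_zero_of_ae ?_
      filter_upwards [Lp.coeFn_zero Plane 2 (volume.restrict Ω)] with x hx
      rw [WithLp.zero_snd, hx]; simp
    rw [e1, e2, neg_zero]
  smul_mem' := by
    intro c w hw φ hφ e
    have e1 : ∫ x in Ω, (c • w).fst x * fderiv ℝ φ x e
        = ∫ x in Ω, c * (w.fst x * fderiv ℝ φ x e) := by
      refine integral_congr_ae ?_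
      filter_upwards [Lp.coeFn_smul c w.fst] with x hx
      rw [WithLp.smul_fst, hx, Pi.smul_apply, smul_eq_mul, mul_assoc]
    have e2 : ∫ x in Ω, (inner ℝ e ((c • w).snd x)) * φ x
        = ∫ x in Ω, c * ((inner ℝ e (w.snd x)) * φ x) := by
      refine integral_congr_ae ?_
      filter_upwards [Lp.coeFn_smul c w.snd] with x hx
      rw [WithLp.smul_snd, hx, Pi.smul_apply, real_inner_smul_right, mul_assoc]
    rw [e1, e2, integral_const_mul, integral_const_mul, hw φ hφ e, mul_neg]

/-- The function underlying an element of `H¹(Ω)`. -/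
def H1.toL2 {Ω : Set Plane} (v : H1 Ω) : L2 Ω := (v : WithLp 2 (L2 Ω × L2Vec Ω)).fst

/-- The weak gradient, as a linear map `H¹(Ω) → L²(Ω)²`. -/
def H1.grad (Ω : Set Plane) : H1 Ω →ₗ[ℝ] L2Vec Ω where
  toFun v := (v : WithLp 2 (L2 Ω × L2Vec Ω)).snd
  map_add' _ _ := rfl
  map_smul' _ _ := rfl

/-- The pairs `(φ|_Ω, φ|_Γ)` in `H¹(Ω) × L²(Γ)`, with `φ` smooth on the whole plane. -/
def smoothPairs (Ω : Set Plane) : Submodule ℝ (H1 Ω × L2Bdry Ω) where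
  carrier := {q | ∃ φ : Plane → ℝ, ContDiff ℝ ∞ φ ∧
    H1.toL2 q.1 =ᵐ[volume.restrict Ω] φ ∧ q.2 =ᵐ[bdryMeasure Ω] φ}
  add_mem' := by
    rintro q q' ⟨φ, hφ, h1, h2⟩ ⟨ψ, hψ, k1, k2⟩
    exact ⟨φ + ψ, hφ.add hψ, (Lp.coeFn_add (H1.toL2 q.1) (H1.toL2 q'.1)).trans (h1.add k1),
      (Lp.coeFn_add q.2 q'.2).trans (h2.add k2)⟩
  zero_mem' := ⟨0, contDiff_const, Lp.coeFn_zero _ _ _, Lp.coeFn_zero _ _ _⟩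
  smul_mem' := by
    rintro c q ⟨φ, hφ, h1, h2⟩
    exact ⟨c • φ, hφ.const_smul c, (Lp.coeFn_smul c (H1.toL2 q.1)).trans (h1.const_smul c),
      (Lp.coeFn_smul c q.2).trans (h2.const_smul c)⟩

/-- The trace operator `γ : H¹(Ω) → L²(Γ)`: the extension by continuity of `φ|_Ω ↦ φ|_Γ` from
smooth functions to `H¹(Ω)`. -/
def trace (Ω : Set Plane) : H1 Ω →L[ℝ] L2Bdry Ω :=
  ((LinearMap.snd ℝ (H1 Ω) (L2Bdry Ω)).comp (smoothPairs Ω).subtype).extendOfNorm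
    ((LinearMap.fst ℝ (H1 Ω) (L2Bdry Ω)).comp (smoothPairs Ω).subtype)

/-- `{v ∈ H¹(Ω) | γ v = 0 a.e. on Γ₁}` as a subspace of `H¹(Ω)`. -/
def vanishing (Ω Γ₁ : Set Plane) : Submodule ℝ (H1 Ω) where
  carrier := {v | ∀ᵐ x ∂(bdryMeasure Ω).restrict Γ₁, trace Ω v x = 0}
  add_mem' := by
    intro v w hv hw
    have h := ae_restrict_of_ae (s := Γ₁) (Lp.coeFn_add (trace Ω v) (trace Ω w))
    change ∀ᵐ x ∂_, trace Ω (v + w) x = 0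
    rw [map_add]
    filter_upwards [h, hv, hw] with x h1 h2 h3
    rw [h1, Pi.add_apply, h2, h3, add_zero]
  zero_mem' := by
    have h := ae_restrict_of_ae (s := Γ₁) (Lp.coeFn_zero ℝ 2 (bdryMeasure Ω))
    change ∀ᵐ x ∂_, trace Ω 0 x = 0
    rw [map_zero]
    filter_upwards [h] with x h1
    rw [h1, Pi.zero_apply]
  smul_mem' := by
    intro c v hv
    have h := ae_restrict_of_ae (s := Γ₁) (Lp.coeFn_smul c (trace Ω v))
    change ∀ᵐ x ∂_, trace Ω (c • v) x = 0
    rw [map_smul]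
    filter_upwards [h, hv] with x h1 h2
    rw [h1, Pi.smul_apply, h2, smul_zero]

/-- The space `X = {v ∈ H¹(Ω) | γ v = 0 a.e. on Γ₁}`. It is a separate type, because it carries
the inner product `(u, v)_X = (∇u, ∇v)_{L²(Ω)²}` and not the one of `H¹(Ω)`. -/
def X (Ω Γ₁ : Set Plane) : Type := vanishing Ω Γ₁

namespace X

variable {Ω Γ₁ : Set Plane}

instance : AddCommGroup (X Ω Γ₁) := inferInstanceAs (AddCommGroup (vanishing Ω Γ₁))

instance : Module ℝ (X Ω Γ₁) := inferInstanceAs (Module ℝ (vanishing Ω Γ₁))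

/-- The inclusion `X ⊆ H¹(Ω)`. -/
def toH1 : X Ω Γ₁ →ₗ[ℝ] H1 Ω := (vanishing Ω Γ₁).subtype

/-- The weak gradient of an element of `X`. -/
def grad : X Ω Γ₁ →ₗ[ℝ] L2Vec Ω := (H1.grad Ω).comp toH1

instance : SeminormedAddCommGroup (X Ω Γ₁) :=
  SeminormedAddCommGroup.induced (X Ω Γ₁) (L2Vec Ω) (grad : X Ω Γ₁ →ₗ[ℝ] L2Vec Ω)

instance : NormedSpace ℝ (X Ω Γ₁) :=
  NormedSpace.induced ℝ (X Ω Γ₁) (L2Vec Ω) (grad : X Ω Γ₁ →ₗ[ℝ] L2Vec Ω)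

instance : InnerProductSpace ℝ (X Ω Γ₁) where
  inner u v := inner ℝ (grad u) (grad v)
  norm_sq_eq_re_inner u := norm_sq_eq_re_inner (𝕜 := ℝ) (grad u)
  conj_inner_symm u v := inner_conj_symm (𝕜 := ℝ) (grad u) (grad v)
  add_left u v w := by rw [map_add, inner_add_left]
  smul_left u v r := by rw [map_smul, inner_smul_left]

end X

/-- `H^{1/2}(Γ) = γ(H¹(Ω)) ⊆ L²(Γ)`. It is a separate type, because it carries the trace norm
`‖w‖ = inf {‖v‖_{H¹(Ω)} | γ v = w}` and not the one of `L²(Γ)`. -/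
def HHalf (Ω : Set Plane) : Type := LinearMap.range (trace Ω : H1 Ω →ₗ[ℝ] L2Bdry Ω)

namespace HHalf

variable {Ω : Set Plane}

instance : AddCommGroup (HHalf Ω) :=
  inferInstanceAs (AddCommGroup (LinearMap.range (trace Ω : H1 Ω →ₗ[ℝ] L2Bdry Ω)))

instance : Module ℝ (HHalf Ω) :=
  inferInstanceAs (Module ℝ (LinearMap.range (trace Ω : H1 Ω →ₗ[ℝ] L2Bdry Ω)))

/-- The canonical linear bijection of `H^{1/2}(Γ)` onto the quotient `H¹(Ω) / Ker γ`. -/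
def toQuotient :
    HHalf Ω →ₗ[ℝ] (H1 Ω ⧸ LinearMap.ker (trace Ω : H1 Ω →ₗ[ℝ] L2Bdry Ω)) :=
  (LinearMap.quotKerEquivRange (trace Ω : H1 Ω →ₗ[ℝ] L2Bdry Ω)).symm.toLinearMap

/-- The quotient norm of `H¹(Ω) / Ker γ`, transported to `H^{1/2}(Γ)`. -/
instance : SeminormedAddCommGroup (HHalf Ω) :=
  SeminormedAddCommGroup.induced (HHalf Ω)
    (H1 Ω ⧸ LinearMap.ker (trace Ω : H1 Ω →ₗ[ℝ] L2Bdry Ω)) (toQuotient (Ω := Ω))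

instance : NormedSpace ℝ (HHalf Ω) :=
  NormedSpace.induced ℝ (HHalf Ω)
    (H1 Ω ⧸ LinearMap.ker (trace Ω : H1 Ω →ₗ[ℝ] L2Bdry Ω)) (toQuotient (Ω := Ω))

end HHalf

/-- The trace operator, as a linear map of `H¹(Ω)` onto `H^{1/2}(Γ)`. -/
def traceHalf (Ω : Set Plane) : H1 Ω →ₗ[ℝ] HHalf Ω :=
  (trace Ω : H1 Ω →ₗ[ℝ] L2Bdry Ω).rangeRestrict

/-- The space `M = γ(X)`, with the norm of `H^{1/2}(Γ)`. -/
abbrev M (Ω Γ₁ : Set Plane) : Submodule ℝ (HHalf Ω) := (vanishing Ω Γ₁).map (traceHalf Ω)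

/-- The trace operator as a linear map `X → M`. -/
def traceM (Ω Γ₁ : Set Plane) : X Ω Γ₁ →ₗ[ℝ] M Ω Γ₁ :=
  ((traceHalf Ω).comp X.toH1).codRestrict (M Ω Γ₁) fun v =>
    Submodule.mem_map_of_mem (Subtype.prop (p := fun w => w ∈ vanishing Ω Γ₁) v)

/-- The space `Y = M'`. -/
abbrev Y (Ω Γ₁ : Set Plane) : Type := StrongDual ℝ (M Ω Γ₁)

/-- The form `b(v, μ) = ⟨μ, γ v⟩_{Y, M}`. -/
def b {Ω Γ₁ : Set Plane} (v : X Ω Γ₁) (μ : Y Ω Γ₁) : ℝ := μ (traceM Ω Γ₁ v)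

/-- The operator `B : X → Y'` associated with `b`. -/
def B (Ω Γ₁ : Set Plane) : X Ω Γ₁ →ₗ[ℝ] StrongDual ℝ (Y Ω Γ₁) :=
  (NormedSpace.inclusionInDoubleDual ℝ (M Ω Γ₁)).toLinearMap.comp (traceM Ω Γ₁)

/-- The defining relation `⟨B v, μ⟩_{Y', Y} = b(v, μ)`. -/
theorem B_apply {Ω Γ₁ : Set Plane} (v : X Ω Γ₁) (μ : Y Ω Γ₁) : B Ω Γ₁ v μ = b v μ := rfl

/-- The polar `K⁰ = {l ∈ X' | ⟨l, v⟩_{X', X} = 0 for all v ∈ K}` of a subspace `K` of `X`. -/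
def polar {Ω Γ₁ : Set Plane} (K : Submodule ℝ (X Ω Γ₁)) : Set (StrongDual ℝ (X Ω Γ₁)) :=
  {l | ∀ v ∈ K, l v = 0}

/-- The functional `j(v) = ∫_{Γ₃} g |γ v| dΓ`. -/
def j {Ω Γ₁ : Set Plane} (Γ₃ : Set Plane) (g : ℝ) (v : X Ω Γ₁) : ℝ :=
  ∫ x in Γ₃, g * |trace Ω v.toH1 x| ∂bdryMeasure Ω

/-- The form `a(u, v) = ξ (u, v)_X`. -/
def a {Ω Γ₁ : Set Plane} (ξ : ℝ) (u v : X Ω Γ₁) : ℝ := ξ * inner ℝ u v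

/-- The load functional `v ↦ (f, v)_X = ∫_Ω f₀ v dx + ∫_{Γ₂} f₂ γ v dΓ`. -/
def load {Ω Γ₁ Γ₂ : Set Plane} (f₀ : L2 Ω) (f₂ : Lp ℝ 2 ((bdryMeasure Ω).restrict Γ₂))
    (v : X Ω Γ₁) : ℝ :=
  (∫ x in Ω, f₀ x * H1.toL2 v.toH1 x) + ∫ x in Γ₂, f₂ x * trace Ω v.toH1 x ∂bdryMeasure Ω

/-- The set of multipliers `Λ̄ = {μ ∈ X' | ⟨μ, v⟩_{X', X} ≤ j(v) for all v ∈ X}`. -/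
def multipliers (Ω Γ₁ Γ₃ : Set Plane) (g : ℝ) : Set (StrongDual ℝ (X Ω Γ₁)) :=
  {μ | ∀ v : X Ω Γ₁, μ v ≤ j Γ₃ g v}

/-- `(u, l) ∈ X × Λ̄` solves the mixed variational problem with multiplier in the dual of `X`. -/
structure IsMixedSolution {Ω Γ₁ Γ₂ : Set Plane} (Γ₃ : Set Plane) (g ξ : ℝ)
    (f₀ : L2 Ω) (f₂ : Lp ℝ 2 ((bdryMeasure Ω).restrict Γ₂))
    (u : X Ω Γ₁) (l : StrongDual ℝ (X Ω Γ₁)) : Prop where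
  mem_multipliers : l ∈ multipliers Ω Γ₁ Γ₃ g
  equation : ∀ v : X Ω Γ₁, a ξ u v + l v = load f₀ f₂ v
  inequality : ∀ μ ∈ multipliers Ω Γ₁ Γ₃ g, (μ - l) u ≤ 0

end FrictionalContact

end

/-!
If `B v = 0`, every continuous functional on `M` kills `γ v`, so by Hahn–Banach `γ v` has norm
zero in `H^{1/2}(Γ)`. That norm is the quotient norm of `H¹(Ω) / Ker γ`, and `Ker γ` is closed
because the trace into `L²(Γ)` is continuous; hence `γ v = 0` in `L²(Γ)`
(`trace_eq_zero_of_mem_ker_B`). Therefore `j(v) = j(-v) = 0`. A multiplier is dominated by `j`, so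
`⟨l, v⟩ ≤ 0` and `⟨l, -v⟩ ≤ 0`, that is, `⟨l, v⟩ = 0` (`multipliers_subset_polar_ker_B`).
Thus all of `Λ̄` lies in the polar of `Ker B`.
-/

namespace FrictionalContact

theorem norm_eq_zero_of_forall_dual_eq_zero {E : Type*} [SeminormedAddCommGroup E]
    [NormedSpace ℝ E] {x : E} (h : ∀ f : StrongDual ℝ E, f x = 0) : ‖x‖ = 0 := by
  obtain ⟨f, -, hf⟩ := exists_dual_vector'' ℝ x
  exact hf.symm.trans (h f)

/-- The seminorm declared on `H^{1/2}(Γ)` is definite, because `Ker γ` is closed in `H¹(Ω)`. -/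
theorem trace_eq_zero_of_norm_traceHalf_eq_zero {Ω : Set Plane} {v : H1 Ω}
    (h : ‖traceHalf Ω v‖ = 0) : trace Ω v = 0 := by
  have e : HHalf.toQuotient (traceHalf Ω v) = Submodule.Quotient.mk v :=
    (LinearEquiv.symm_apply_eq _).2 rfl
  have h' : ‖(Submodule.Quotient.mk v :
      H1 Ω ⧸ LinearMap.ker (trace Ω : H1 Ω →ₗ[ℝ] L2Bdry Ω))‖ = 0 := by
    rw [← e]
    exact h
  exact (trace Ω).isClosed_ker.closure_subset
    (QuotientAddGroup.norm_mk_eq_zero_iff_mem_closure.1 h')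

theorem trace_eq_zero_of_mem_ker_B {Ω Γ₁ : Set Plane} {v : X Ω Γ₁}
    (hv : v ∈ LinearMap.ker (B Ω Γ₁)) : trace Ω v.toH1 = 0 := by
  have h : ‖traceM Ω Γ₁ v‖ = 0 :=
    norm_eq_zero_of_forall_dual_eq_zero fun μ => DFunLike.congr_fun (LinearMap.mem_ker.1 hv) μ
  exact trace_eq_zero_of_norm_traceHalf_eq_zero h

theorem j_eq_zero_of_trace_eq_zero {Ω Γ₁ : Set Plane} (Γ₃ : Set Plane) (g : ℝ) {v : X Ω Γ₁}
    (hv : trace Ω v.toH1 = 0) : j Γ₃ g v = 0 := by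
  refine integral_eq_zero_of_ae ?_
  rw [hv]
  filter_upwards [ae_restrict_of_ae (s := Γ₃) (Lp.coeFn_zero ℝ 2 (bdryMeasure Ω))] with x hx
  change g * |(0 : L2Bdry Ω) x| = 0
  rw [hx, Pi.zero_apply, abs_zero, mul_zero]

theorem multipliers_subset_polar_ker_B (Ω Γ₁ Γ₃ : Set Plane) (g : ℝ) :
    multipliers Ω Γ₁ Γ₃ g ⊆ polar (LinearMap.ker (B Ω Γ₁)) := by
  intro l hl v hv
  have nonpos : ∀ w ∈ LinearMap.ker (B Ω Γ₁), l w ≤ 0 := fun w hw =>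
    (hl w).trans_eq (j_eq_zero_of_trace_eq_zero Γ₃ g (trace_eq_zero_of_mem_ker_B hw))
  have hneg := nonpos (-v) (neg_mem hv)
  rw [map_neg] at hneg
  exact le_antisymm (nonpos v hv) (neg_nonpos.1 hneg)

end FrictionalContact

theorem mainTheorem3
    (Ω Γ₁ Γ₂ Γ₃ : Set FrictionalContact.Plane)
    (hΩ_open : IsOpen Ω) (hΩ_conn : IsConnected Ω) (hΩ_bdd : Bornology.IsBounded Ω)
    (hΩ_smooth : FrictionalContact.HasSmoothBoundary Ω)
    (hΓ_union : Γ₁ ∪ Γ₂ ∪ Γ₃ = frontier Ω)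
    (h12 : Disjoint Γ₁ Γ₂) (h13 : Disjoint Γ₁ Γ₃) (h23 : Disjoint Γ₂ Γ₃)
    (hm1 : NullMeasurableSet Γ₁ (FrictionalContact.bdryMeasure Ω))
    (hm2 : NullMeasurableSet Γ₂ (FrictionalContact.bdryMeasure Ω))
    (hm3 : NullMeasurableSet Γ₃ (FrictionalContact.bdryMeasure Ω))
    (hp1 : 0 < FrictionalContact.bdryMeasure Ω Γ₁)
    (hp2 : 0 < FrictionalContact.bdryMeasure Ω Γ₂)
    (hp3 : 0 < FrictionalContact.bdryMeasure Ω Γ₃)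
    (g ξ : ℝ) (hg : 0 < g) (hξ : 0 < ξ)
    (f₀ : FrictionalContact.L2 Ω)
    (f₂ : Lp ℝ 2 ((FrictionalContact.bdryMeasure Ω).restrict Γ₂))
    (u : FrictionalContact.X Ω Γ₁) (l : StrongDual ℝ (FrictionalContact.X Ω Γ₁))
    (hsol : FrictionalContact.IsMixedSolution Γ₃ g ξ f₀ f₂ u l) :
    l ∈ FrictionalContact.polar (LinearMap.ker (FrictionalContact.B Ω Γ₁)) :=
  FrictionalContact.multipliers_subset_polar_ker_B Ω Γ₁ Γ₃ g hsol.mem_multipliers
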